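/- **Theorem 3.1.** Let $(\mathscr C,\mathbb E,\mathfrak s)$ be an extriangulated category. Then $\mathscr C$ has an $\mathbb E$-compatible triangulated structure $(\mathscr C,T,\mathcal T)$ if and only if, for every object $X\in\mathscr C$, the morphism $X\to 0$ is an $\mathbb E$-inflation and the morphism $0\to X$ is an $\mathbb E$-deflation. The terms are understood as follows. *Extriangulated category* (Nakaoka–Palu). $\mathscr C$ is an additive category, $\mathbb E\colon\mathscr C^{\mathrm{op}}\times\mathscr C\to \mathrm{Ab}$ is a biadditive functor (write $a_*\delta=\mathbb E(C,a)(\delta)$ and $c^*\delta=\mathbb E(c,A)(\delta)$ for $\delta\in\mathbb E(C,A)$), and $\mathfrak s$ assigns to each $\delta\in\mathbb E(C,A)$ an equivalence class $\mathfrak s(\delta)=[A\xrightarrow{x}B\xrightarrow{y}C]$ of sequences, where $(B,x,y)\sim(B',x',y')$ means that there is an isomorphism $b\colon B\to B'$ with $bx=x'$ and $y'b=y$; one says that the sequence *realises* $\delta$. The following hold. * (ET2) Let $\delta\in\mathbb E(C,A)$ and $\delta'\in\mathbb E(C',A')$ be realised by $A\xrightarrow{x}B\xrightarrow{y}C$ and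 $A'\xrightarrow{x'}B'\xrightarrow{y'}C'$. If $a\colon A\to A'$ and $c\colon C\to C'$ satisfy $a_*\delta=c^*\delta'$, then there is $b\colon B\to B'$ with $bx=x'a$ and $y'b=cy$. Moreover $0\in\mathbb E(C,A)$ is realised by the split sequence $A\to A\oplus C\to C$, and $(i_A)_*(p_C)^*\delta+(i_{A'})_*(p_{C'})^*\delta'$ is realised by the direct sum of the two sequences, where $i_A,i_{A'}$ are the inclusions into $A\oplus A'$ and $p_C,p_{C'}$ the projections from $C\oplus C'$. * (ET3) With $\delta,\delta'$ realised as above, if $a\colon A\to A'$ and $b\colon B\to B'$ satisfy $bx=x'a$, then there is $c\colon C\to C'$ with $a_*\delta=c^*\delta'$ and $y'b=cy$. * (ET4) If $\delta\in\mathbb E(D,A)$ is realised by $A\xrightarrow{f}B\xrightarrow{f'}D$ and $\delta'\in\mathbb E(F,B)$ by $B\xrightarrow{g}C\xrightarrow{g'}F$, then there are an object $E$, morphisms $h'\colon C\to E$, $d\colon D\to E$, $e\colon E\to F$ with $df'=h'g$ and $eh'=g'$, and $\delta''\in\mathbb E(E,A)$ realised by $A\xrightarrow{gf}C\xrightarrow{h'}E$,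 such that $(f')_*\delta'$ is realised by $D\xrightarrow{d}E\xrightarrow{e}F$, $d^*\delta''=\delta$ and $f_*\delta''=e^*\delta'$. * (ET3)$^{\mathrm{op}}$ and (ET4)$^{\mathrm{op}}$: the duals of (ET3) and (ET4). *Triangles, inflations, deflations.* If $A\xrightarrow{x}B\xrightarrow{y}C$ realises $\delta$, then $A\xrightarrow{x}B\xrightarrow{y}C\overset{\delta}{\dashrightarrow}$ is an *$\mathbb E$-triangle*, $x$ is an *$\mathbb E$-inflation* and $y$ is an *$\mathbb E$-deflation*. *Triangulated structure.* $T$ is an auto-equivalence of $\mathscr C$ and $\mathcal T$ is a class of sextuples $X\xrightarrow{u}Y\xrightarrow{v}Z\xrightarrow{w}TX$, called distinguished triangles, satisfying the usual axioms (TR1)–(TR4), including the octahedral axiom (TR4). *Compatibility.* $(\mathscr C,T,\mathcal T)$ is *$\mathbb E$-compatible* if for every distinguished triangle $X\xrightarrow{u}Y\xrightarrow{v}Z\xrightarrow{w}TX$ there is some $\delta\in\mathbb E(Z,X)$ such that $X\xrightarrow{u}Y\xrightarrow{v}Z\overset{\delta}{\dashrightarrow}$ is an $\mathbb E$-triangle.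 -/

import Mathlib

open CategoryTheory CategoryTheory.Limits Opposite
open scoped ZeroObject

universe w v u

noncomputable section

namespace Extriangulated

/-- A sequence of two morphisms `A ⟶ B ⟶ C` with prescribed end terms `A` and `C`. -/
structure Seq {𝒞 : Type u} [Category.{v} 𝒞] (A C : 𝒞) where
  /-- the middle term -/
  mid : 𝒞
  /-- the first morphism -/
  fst : A ⟶ mid
  /-- the second morphism -/
  snd : mid ⟶ C

/-- Two sequences with the same end terms are equivalent if there is an isomorphism between
their middle terms which, with the identities of the end terms, makes both squares commute. -/
def Seq.Equivalent {𝒞 : Type u} [Category.{v} 𝒞] {A C : 𝒞} (S S' : Seq A C) : Prop :=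
  ∃ b : S.mid ≅ S'.mid, S.fst ≫ b.hom = S'.fst ∧ b.hom ≫ S'.snd = S.snd

/-- Equivalence of sequences, as a setoid. -/
def Seq.setoid {𝒞 : Type u} [Category.{v} 𝒞] (A C : 𝒞) : Setoid (Seq A C) where
  r := Seq.Equivalent
  iseqv :=
    { refl := fun S => ⟨Iso.refl _, by simp, by simp⟩
      symm := by
        rintro S S' ⟨b, h₁, h₂⟩
        exact ⟨b.symm, by simp [← h₁], by simp [← h₂]⟩
      trans := by
        rintro S S' S'' ⟨b, h₁, h₂⟩ ⟨b', h₁', h₂'⟩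
        exact ⟨b ≪≫ b', by simp [← h₁', ← h₁], by simp [← h₂, ← h₂']⟩ }

/-- The equivalence classes of sequences `A ⟶ B ⟶ C` with fixed end terms. -/
def SeqClass {𝒞 : Type u} [Category.{v} 𝒞] (A C : 𝒞) : Type (max u v) :=
  Quotient (Seq.setoid A C)

/-- The equivalence class `[A ⟶ B ⟶ C]`. -/
def SeqClass.mk {𝒞 : Type u} [Category.{v} 𝒞] {A B C : 𝒞} (x : A ⟶ B) (y : B ⟶ C) :
    SeqClass A C :=
  Quotient.mk (Seq.setoid A C) ⟨B, x, y⟩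

/-- The abelian group `𝔼(C, A)` of `𝔼`-extensions, for a bifunctor `𝔼 : 𝒞ᵒᵖ × 𝒞 ⥤ Ab`
(in curried form). -/
abbrev Ext {𝒞 : Type u} [Category.{v} 𝒞] (𝔼 : 𝒞ᵒᵖ ⥤ 𝒞 ⥤ AddCommGrpCat.{w}) (C A : 𝒞) : Type w :=
  (𝔼.obj (op C)).obj A

/-- `a_* δ = 𝔼(C, a)(δ)`. -/
def push {𝒞 : Type u} [Category.{v} 𝒞] (𝔼 : 𝒞ᵒᵖ ⥤ 𝒞 ⥤ AddCommGrpCat.{w}) {A A' C : 𝒞}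
    (a : A ⟶ A') (δ : Ext 𝔼 C A) : Ext 𝔼 C A' :=
  ((𝔼.obj (op C)).map a).hom δ

/-- `c^* δ = 𝔼(c, A)(δ)`. -/
def pull {𝒞 : Type u} [Category.{v} 𝒞] (𝔼 : 𝒞ᵒᵖ ⥤ 𝒞 ⥤ AddCommGrpCat.{w}) {A C C' : 𝒞}
    (c : C' ⟶ C) (δ : Ext 𝔼 C A) : Ext 𝔼 C' A :=
  ((𝔼.map c.op).app A).hom δ

end Extriangulated

open Extriangulated in
/-- An extriangulated structure `(𝔼, 𝔰)` on an additive category `𝒞`. -/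
structure ExtriangulatedStructure (𝒞 : Type u) [Category.{v} 𝒞] [Preadditive 𝒞]
    [HasZeroObject 𝒞] [HasBinaryBiproducts 𝒞] where
  /-- the bifunctor `𝔼 : 𝒞ᵒᵖ × 𝒞 ⥤ Ab` -/
  𝔼 : 𝒞ᵒᵖ ⥤ 𝒞 ⥤ AddCommGrpCat.{w}
  /-- (ET1) `𝔼` is additive in the covariant variable -/
  additive_right : ∀ C : 𝒞, (𝔼.obj (op C)).Additive
  /-- (ET1) `𝔼` is additive in the contravariant variable -/
  additive_left : ∀ A : 𝒞, (𝔼.flip.obj A).Additive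
  /-- the correspondence `𝔰`, sending an extension to an equivalence class of sequences -/
  𝔰 : ∀ {A C : 𝒞}, Ext 𝔼 C A → SeqClass A C
  /-- (ET2) `𝔰` is a realisation: every morphism of extensions is realised -/
  realisation : ∀ {A B C A' B' C' : 𝒞} (δ : Ext 𝔼 C A) (δ' : Ext 𝔼 C' A')
    (x : A ⟶ B) (y : B ⟶ C) (x' : A' ⟶ B') (y' : B' ⟶ C'),
    𝔰 δ = SeqClass.mk x y → 𝔰 δ' = SeqClass.mk x' y' →
    ∀ (a : A ⟶ A') (c : C ⟶ C'), push 𝔼 a δ = pull 𝔼 c δ' →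
      ∃ b : B ⟶ B', x ≫ b = a ≫ x' ∧ y ≫ c = b ≫ y'
  /-- (ET2) split extensions are realised by split sequences -/
  realisation_zero : ∀ A C : 𝒞,
    𝔰 (0 : Ext 𝔼 C A) = SeqClass.mk (biprod.inl : A ⟶ A ⊞ C) (biprod.snd : A ⊞ C ⟶ C)
  /-- (ET2) direct sums of extensions are realised by direct sums of sequences -/
  realisation_add : ∀ {A B C A' B' C' : 𝒞} (δ : Ext 𝔼 C A) (δ' : Ext 𝔼 C' A')
    (x : A ⟶ B) (y : B ⟶ C) (x' : A' ⟶ B') (y' : B' ⟶ C'),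
    𝔰 δ = SeqClass.mk x y → 𝔰 δ' = SeqClass.mk x' y' →
    𝔰 (push 𝔼 (biprod.inl : A ⟶ A ⊞ A') (pull 𝔼 (biprod.fst : C ⊞ C' ⟶ C) δ) +
        push 𝔼 (biprod.inr : A' ⟶ A ⊞ A') (pull 𝔼 (biprod.snd : C ⊞ C' ⟶ C') δ')) =
      SeqClass.mk (biprod.map x x') (biprod.map y y')
  /-- (ET3) -/
  et3 : ∀ {A B C A' B' C' : 𝒞} (δ : Ext 𝔼 C A) (δ' : Ext 𝔼 C' A')
    (x : A ⟶ B) (y : B ⟶ C) (x' : A' ⟶ B') (y' : B' ⟶ C'),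
    𝔰 δ = SeqClass.mk x y → 𝔰 δ' = SeqClass.mk x' y' →
    ∀ (a : A ⟶ A') (b : B ⟶ B'), x ≫ b = a ≫ x' →
      ∃ c : C ⟶ C', push 𝔼 a δ = pull 𝔼 c δ' ∧ y ≫ c = b ≫ y'
  /-- (ET3)ᵒᵖ -/
  et3op : ∀ {A B C A' B' C' : 𝒞} (δ : Ext 𝔼 C A) (δ' : Ext 𝔼 C' A')
    (x : A ⟶ B) (y : B ⟶ C) (x' : A' ⟶ B') (y' : B' ⟶ C'),
    𝔰 δ = SeqClass.mk x y → 𝔰 δ' = SeqClass.mk x' y' →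
    ∀ (b : B ⟶ B') (c : C ⟶ C'), y ≫ c = b ≫ y' →
      ∃ a : A ⟶ A', push 𝔼 a δ = pull 𝔼 c δ' ∧ x ≫ b = a ≫ x'
  /-- (ET4) -/
  et4 : ∀ {A B C D F : 𝒞} (δ : Ext 𝔼 D A) (δ' : Ext 𝔼 F B)
    (f : A ⟶ B) (f' : B ⟶ D) (g : B ⟶ C) (g' : C ⟶ F),
    𝔰 δ = SeqClass.mk f f' → 𝔰 δ' = SeqClass.mk g g' →
    ∃ (E : 𝒞) (h' : C ⟶ E) (d : D ⟶ E) (e : E ⟶ F) (δ'' : Ext 𝔼 E A),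
      f' ≫ d = g ≫ h' ∧ h' ≫ e = g' ∧
      𝔰 δ'' = SeqClass.mk (f ≫ g) h' ∧
      𝔰 (push 𝔼 f' δ') = SeqClass.mk d e ∧
      pull 𝔼 d δ'' = δ ∧
      push 𝔼 f δ'' = pull 𝔼 e δ'
  /-- (ET4)ᵒᵖ, obtained from (ET4) by reversing all arrows and exchanging `push` and `pull` -/
  et4op : ∀ {A B C D F : 𝒞} (δ : Ext 𝔼 A D) (δ' : Ext 𝔼 B F)
    (f' : D ⟶ B) (f : B ⟶ A) (g' : F ⟶ C) (g : C ⟶ B),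
    𝔰 δ = SeqClass.mk f' f → 𝔰 δ' = SeqClass.mk g' g →
    ∃ (E : 𝒞) (h' : E ⟶ C) (d : E ⟶ D) (e : F ⟶ E) (δ'' : Ext 𝔼 A E),
      d ≫ f' = h' ≫ g ∧ e ≫ h' = g' ∧
      𝔰 δ'' = SeqClass.mk h' (g ≫ f) ∧
      𝔰 (pull 𝔼 f' δ') = SeqClass.mk e d ∧
      push 𝔼 d δ'' = δ ∧
      pull 𝔼 f δ'' = push 𝔼 e δ'

namespace ExtriangulatedStructure

open Extriangulated

/-- `A ⟶ B ⟶ C`, together with `δ`, is an `𝔼`-triangle: the sequence realises `δ`. -/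
def IsETriangle {𝒞 : Type u} [Category.{v} 𝒞] [Preadditive 𝒞] [HasZeroObject 𝒞]
    [HasBinaryBiproducts 𝒞] (𝓔 : ExtriangulatedStructure.{w} 𝒞) {A B C : 𝒞}
    (x : A ⟶ B) (y : B ⟶ C) (δ : Ext 𝓔.𝔼 C A) : Prop :=
  𝓔.𝔰 δ = SeqClass.mk x y

/-- `A ⟶ B ⟶ C` is an `𝔼`-conflation: it realises some extension. -/
def IsConflation {𝒞 : Type u} [Category.{v} 𝒞] [Preadditive 𝒞] [HasZeroObject 𝒞]
    [HasBinaryBiproducts 𝒞] (𝓔 : ExtriangulatedStructure.{w} 𝒞) {A B C : 𝒞}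
    (x : A ⟶ B) (y : B ⟶ C) : Prop :=
  ∃ δ : Ext 𝓔.𝔼 C A, 𝓔.IsETriangle x y δ

/-- `f` is an `𝔼`-inflation: it is the first morphism of some conflation. -/
def IsInflation {𝒞 : Type u} [Category.{v} 𝒞] [Preadditive 𝒞] [HasZeroObject 𝒞]
    [HasBinaryBiproducts 𝒞] (𝓔 : ExtriangulatedStructure.{w} 𝒞) {A B : 𝒞} (f : A ⟶ B) : Prop :=
  ∃ (C : 𝒞) (y : B ⟶ C), 𝓔.IsConflation f y

/-- `g` is an `𝔼`-deflation: it is the second morphism of some conflation. -/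
def IsDeflation {𝒞 : Type u} [Category.{v} 𝒞] [Preadditive 𝒞] [HasZeroObject 𝒞]
    [HasBinaryBiproducts 𝒞] (𝓔 : ExtriangulatedStructure.{w} 𝒞) {B C : 𝒞} (g : B ⟶ C) : Prop :=
  ∃ (A : 𝒞) (x : A ⟶ B), 𝓔.IsConflation x g

end ExtriangulatedStructure

/-- A triangulated structure `(T, 𝒯)` on an additive category, where `T` is an arbitrary
auto-equivalence. (Mathlib's `Pretriangulated` is relative to a coherent action of `ℤ` by shift
functors, which is more data than the single auto-equivalence `T`.) An equivalence of additive
categories is automatically additive, so additivity of `T` is not a separate axiom. -/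
structure TriangulatedStructure (𝒞 : Type u) [Category.{v} 𝒞] [Preadditive 𝒞]
    [HasZeroObject 𝒞] [HasBinaryBiproducts 𝒞] where
  /-- the auto-equivalence -/
  T : 𝒞 ⥤ 𝒞
  /-- `T` is an equivalence of categories -/
  isEquivalence : T.IsEquivalence
  /-- the class `𝒯` of distinguished triangles `X ⟶ Y ⟶ Z ⟶ T X` -/
  Dist : ∀ {X Y Z : 𝒞}, (X ⟶ Y) → (Y ⟶ Z) → (Z ⟶ T.obj X) → Prop
  /-- (TR1) a sextuple isomorphic to a distinguished triangle is distinguished -/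
  tr1_iso : ∀ {X Y Z X' Y' Z' : 𝒞} (u : X ⟶ Y) (v : Y ⟶ Z) (w : Z ⟶ T.obj X)
    (u' : X' ⟶ Y') (v' : Y' ⟶ Z') (w' : Z' ⟶ T.obj X') (f : X ≅ X') (g : Y ≅ Y') (h : Z ≅ Z'),
    u ≫ g.hom = f.hom ≫ u' → v ≫ h.hom = g.hom ≫ v' → w ≫ T.map f.hom = h.hom ≫ w' →
    Dist u v w → Dist u' v' w'
  /-- (TR1) every morphism embeds into a distinguished triangle -/
  tr1_exists : ∀ {X Y : 𝒞} (u : X ⟶ Y),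
    ∃ (Z : 𝒞) (v : Y ⟶ Z) (w : Z ⟶ T.obj X), Dist u v w
  /-- (TR1) the triangle `X ⟶ X ⟶ 0 ⟶ T X` given by the identity is distinguished -/
  tr1_id : ∀ X : 𝒞, Dist (𝟙 X) (0 : X ⟶ (0 : 𝒞)) (0 : (0 : 𝒞) ⟶ T.obj X)
  /-- (TR2) rotation -/
  tr2 : ∀ {X Y Z : 𝒞} (u : X ⟶ Y) (v : Y ⟶ Z) (w : Z ⟶ T.obj X),
    Dist u v w → Dist v w (-(T.map u))
  /-- (TR3) completion of a commutative square to a morphism of triangles -/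
  tr3 : ∀ {X Y Z X' Y' Z' : 𝒞} (u : X ⟶ Y) (v : Y ⟶ Z) (w : Z ⟶ T.obj X)
    (u' : X' ⟶ Y') (v' : Y' ⟶ Z') (w' : Z' ⟶ T.obj X'), Dist u v w → Dist u' v' w' →
    ∀ (f : X ⟶ X') (g : Y ⟶ Y'), u ≫ g = f ≫ u' →
      ∃ h : Z ⟶ Z', v ≫ h = g ≫ v' ∧ w ≫ T.map f = h ≫ w'
  /-- (TR4) the octahedral axiom -/
  tr4 : ∀ {X Y Z X' Y' Z' : 𝒞} (u : X ⟶ Y) (i : Y ⟶ Z') (i' : Z' ⟶ T.obj X)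
    (v : Y ⟶ Z) (j : Z ⟶ X') (j' : X' ⟶ T.obj Y) (k : Z ⟶ Y') (k' : Y' ⟶ T.obj X),
    Dist u i i' → Dist v j j' → Dist (u ≫ v) k k' →
    ∃ (f : Z' ⟶ Y') (g : Y' ⟶ X'),
      i ≫ f = v ≫ k ∧ f ≫ k' = i' ∧ k ≫ g = j ∧ k' ≫ T.map u = g ≫ j' ∧
      Dist f g (j' ≫ T.map i)

/-- A triangulated structure is `𝔼`-compatible if every distinguished triangle
`X ⟶ Y ⟶ Z ⟶ T X` yields an `𝔼`-triangle `X ⟶ Y ⟶ Z ⇢ δ` for some `δ ∈ 𝔼(Z, X)`. -/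
def TriangulatedStructure.IsCompatible {𝒞 : Type u} [Category.{v} 𝒞] [Preadditive 𝒞]
    [HasZeroObject 𝒞] [HasBinaryBiproducts 𝒞] (𝓣 : TriangulatedStructure 𝒞)
    (𝓔 : ExtriangulatedStructure.{w} 𝒞) : Prop :=
  ∀ {X Y Z : 𝒞} (u : X ⟶ Y) (v : Y ⟶ Z) (w : Z ⟶ 𝓣.T.obj X), 𝓣.Dist u v w →
    ∃ δ : Extriangulated.Ext 𝓔.𝔼 Z X, 𝓔.IsETriangle u v δ

end

noncomputable section

namespace Extriangulated

variable {𝒞 : Type u} [Category.{v} 𝒞]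

/-! An `𝔼`-triangle `X ⟶ 0 ⟶ TX` makes its extension universal on both sides: `Hom(W, TX) ≅ 𝔼(W, X)`
by pullback and `Hom(X, W) ≅ 𝔼(TX, W)` by pushout (`exists_pull_eq`, `exists_push_eq` and the two
injectivity lemmas). Choosing such triangles makes `T` a functor, fully faithful by comparing both
bijections; the condition on `0 ⟶ X` makes it dense.

A triangle is declared distinguished when its first two maps realise the extension classified by the
third, so compatibility is built in. TR3 and TR4 are then ET3 and ET4 read through the bijection.
Existence of cones and rotation both come from one use of ET4 (`exists_isETriangle_rotate`), and
`exists_iso_right` transfers results between cones. Conversely, TR1 and a rotated identity triangle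
supply the inflations and deflations. -/

theorem SeqClass.mk_eq_mk_iff {A B B' C : 𝒞} {x : A ⟶ B} {y : B ⟶ C} {x' : A ⟶ B'}
    {y' : B' ⟶ C} : SeqClass.mk x y = SeqClass.mk x' y' ↔
      ∃ b : B ≅ B', x ≫ b.hom = x' ∧ b.hom ≫ y' = y :=
  ⟨fun h => Quotient.exact h, fun h => Quotient.sound h⟩

theorem SeqClass.exists_eq_mk {A C : 𝒞} (S : SeqClass A C) :
    ∃ (B : 𝒞) (x : A ⟶ B) (y : B ⟶ C), S = SeqClass.mk x y := by
  obtain ⟨⟨B, x, y⟩, rfl⟩ := Quotient.exists_rep S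
  exact ⟨B, x, y, rfl⟩

/-! ### Functoriality of extensions -/

section

variable (𝔼 : 𝒞ᵒᵖ ⥤ 𝒞 ⥤ AddCommGrpCat.{w})

@[simp]
theorem push_id {A C : 𝒞} (δ : Ext 𝔼 C A) : push 𝔼 (𝟙 A) δ = δ := by
  simp [push]

@[simp]
theorem pull_id {A C : 𝒞} (δ : Ext 𝔼 C A) : pull 𝔼 (𝟙 C) δ = δ := by
  simp [pull]

theorem push_comp {A A' A'' C : 𝒞} (a : A ⟶ A') (a' : A' ⟶ A'') (δ : Ext 𝔼 C A) :
    push 𝔼 (a ≫ a') δ = push 𝔼 a' (push 𝔼 a δ) := by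
  simp [push]

theorem pull_comp {A C C' C'' : 𝒞} (c : C'' ⟶ C') (c' : C' ⟶ C) (δ : Ext 𝔼 C A) :
    pull 𝔼 (c ≫ c') δ = pull 𝔼 c (pull 𝔼 c' δ) := by
  simp [pull]

theorem push_pull {A A' C C' : 𝒞} (a : A ⟶ A') (c : C' ⟶ C) (δ : Ext 𝔼 C A) :
    push 𝔼 a (pull 𝔼 c δ) = pull 𝔼 c (push 𝔼 a δ) :=
  (ConcreteCategory.congr_hom ((𝔼.map c.op).naturality a) δ).symm

@[simp]
theorem push_map_zero {A A' C : 𝒞} (a : A ⟶ A') : push 𝔼 a (0 : Ext 𝔼 C A) = 0 :=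
  map_zero _

@[simp]
theorem pull_map_zero {A C C' : 𝒞} (c : C' ⟶ C) : pull 𝔼 c (0 : Ext 𝔼 C A) = 0 :=
  map_zero _

end

end Extriangulated

namespace ExtriangulatedStructure

open Extriangulated

variable {𝒞 : Type u} [Category.{v} 𝒞] [Preadditive 𝒞] [HasZeroObject 𝒞]
  [HasBinaryBiproducts 𝒞] (𝓔 : ExtriangulatedStructure.{w} 𝒞)

@[simp]
theorem zero_pull {A C C' : 𝒞} (δ : Ext 𝓔.𝔼 C A) : pull 𝓔.𝔼 (0 : C' ⟶ C) δ = 0 := by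
  have := 𝓔.additive_left A
  have h := (𝓔.𝔼.flip.obj A).map_zero (op C) (op C')
  exact ConcreteCategory.congr_hom h δ

theorem neg_push {A A' C : 𝒞} (a : A ⟶ A') (δ : Ext 𝓔.𝔼 C A) :
    push 𝓔.𝔼 (-a) δ = -push 𝓔.𝔼 a δ := by
  have := 𝓔.additive_right C
  simp [push, Functor.map_neg]

theorem neg_pull {A C C' : 𝒞} (c : C' ⟶ C) (δ : Ext 𝓔.𝔼 C A) :
    pull 𝓔.𝔼 (-c) δ = -pull 𝓔.𝔼 c δ := by
  have := 𝓔.additive_left A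
  have h := (𝓔.𝔼.flip.obj A).map_neg (f := c.op)
  exact ConcreteCategory.congr_hom h δ

theorem sub_pull {A C C' : 𝒞} (c c' : C' ⟶ C) (δ : Ext 𝓔.𝔼 C A) :
    pull 𝓔.𝔼 (c - c') δ = pull 𝓔.𝔼 c δ - pull 𝓔.𝔼 c' δ := by
  have := 𝓔.additive_left A
  have h := (𝓔.𝔼.flip.obj A).map_sub (f := c.op) (g := c'.op)
  exact ConcreteCategory.congr_hom h δ

theorem sub_push {A A' C : 𝒞} (a a' : A ⟶ A') (δ : Ext 𝓔.𝔼 C A) :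
    push 𝓔.𝔼 (a - a') δ = push 𝓔.𝔼 a δ - push 𝓔.𝔼 a' δ := by
  have := 𝓔.additive_right C
  simp [push, Functor.map_sub]

variable {𝓔}

/-! ### Factorisation through the maps of an `𝔼`-triangle -/

namespace IsETriangle

variable {A B C : 𝒞} {x : A ⟶ B} {y : B ⟶ C} {δ : Ext 𝓔.𝔼 C A}

theorem comp_iso {B' : 𝒞} (h : 𝓔.IsETriangle x y δ) (b : B ≅ B') :
    𝓔.IsETriangle (x ≫ b.hom) (b.inv ≫ y) δ :=
  Eq.trans h (SeqClass.mk_eq_mk_iff.2 ⟨b, rfl, by simp⟩)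

theorem zero_left (C : 𝒞) : 𝓔.IsETriangle (0 : (0 : 𝒞) ⟶ C) (𝟙 C) 0 :=
  (𝓔.realisation_zero 0 C).trans
    (SeqClass.mk_eq_mk_iff.2 ⟨⟨biprod.snd, biprod.inr, by ext; all_goals simp, by simp⟩,
      by simp, by simp⟩)

theorem zero_right (A : 𝒞) : 𝓔.IsETriangle (𝟙 A) (0 : A ⟶ (0 : 𝒞)) 0 :=
  (𝓔.realisation_zero A 0).trans
    (SeqClass.mk_eq_mk_iff.2 ⟨⟨biprod.fst, biprod.inl, by ext; all_goals simp, by simp⟩,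
      by simp, (isZero_zero 𝒞).eq_of_tgt _ _⟩)

/-- A morphism killed by the inflation factors through the deflation. -/
theorem exists_desc (h : 𝓔.IsETriangle x y δ) {W : 𝒞} (t : B ⟶ W) (ht : x ≫ t = 0) :
    ∃ s : C ⟶ W, y ≫ s = t := by
  obtain ⟨s, -, hs⟩ := 𝓔.et3 δ 0 x y _ _ h (zero_left W) 0 t (by simp [ht])
  exact ⟨s, by simpa using hs⟩

/-- A morphism along which the extension becomes split factors through the deflation. -/
theorem exists_lift (h : 𝓔.IsETriangle x y δ) {W : 𝒞} (t : W ⟶ C)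
    (ht : pull 𝓔.𝔼 t δ = 0) : ∃ s : W ⟶ B, s ≫ y = t := by
  -- The pulled-back extension splits, so the lift is the section `W ⟶ A ⊞ W` followed by the middle
  -- map.
  obtain ⟨b, -, hb⟩ := 𝓔.realisation 0 δ _ _ x y (𝓔.realisation_zero A W) h (𝟙 A) t (by simp [ht])
  exact ⟨biprod.inr ≫ b, by simp [← hb]⟩

/-- A morphism along which the extension becomes split factors through the inflation. -/
theorem exists_extend (h : 𝓔.IsETriangle x y δ) {W : 𝒞} (t : A ⟶ W)
    (ht : push 𝓔.𝔼 t δ = 0) : ∃ s : B ⟶ W, x ≫ s = t := by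
  obtain ⟨b, hb, -⟩ := 𝓔.realisation δ 0 x y _ _ h (𝓔.realisation_zero W C) t (𝟙 C) (by simp [ht])
  exact ⟨b ≫ biprod.fst, by simp [reassoc_of% hb]⟩

end IsETriangle

end ExtriangulatedStructure

/-! ### Uniqueness of realisations and of cones -/

/-- With `f = 1 + n` and `n² = 0`, the inverse is `1 - n = 2 - f`. -/
theorem CategoryTheory.Preadditive.isIso_of_sub_id_comp_sub_id {𝒞 : Type u} [Category.{v} 𝒞]
    [Preadditive 𝒞] {X : 𝒞} (f : X ⟶ X) (h : (f - 𝟙 X) ≫ (f - 𝟙 X) = 0) : IsIso f := by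
  have h' : f ≫ f = f + f - 𝟙 X := by
    simp only [Preadditive.comp_sub, Preadditive.sub_comp, Category.id_comp, Category.comp_id] at h
    rw [← sub_eq_zero, ← h]; abel
  refine ⟨𝟙 X + 𝟙 X - f, ?_, ?_⟩ <;>
    simp only [Preadditive.comp_sub, Preadditive.sub_comp, Preadditive.comp_add,
      Preadditive.add_comp, Category.id_comp, Category.comp_id, h'] <;> abel

theorem CategoryTheory.isIso_of_isIso_comp_comp {𝒞 : Type u} [Category.{v} 𝒞] {X Y : 𝒞}
    (f : X ⟶ Y) (g : Y ⟶ X) (h : IsIso (f ≫ g)) (h' : IsIso (g ≫ f)) : IsIso f := by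
  have : IsSplitMono f := ⟨⟨g ≫ inv (f ≫ g), by rw [← Category.assoc, IsIso.hom_inv_id]⟩⟩
  have : IsSplitEpi f := ⟨⟨inv (g ≫ f) ≫ g, by rw [Category.assoc, IsIso.inv_hom_id]⟩⟩
  exact isIso_of_mono_of_isSplitEpi f

namespace ExtriangulatedStructure

open Extriangulated

variable {𝒞 : Type u} [Category.{v} 𝒞] [Preadditive 𝒞] [HasZeroObject 𝒞]
  [HasBinaryBiproducts 𝒞] {𝓔 : ExtriangulatedStructure.{w} 𝒞}

namespace IsETriangle

/-- Since `b - 1` kills `x`, it factors through `y`; as it is also killed by `y`, its square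
vanishes. This replaces a five lemma. -/
theorem isIso_mid_of_endo {A B C : 𝒞} {x : A ⟶ B} {y : B ⟶ C} {δ : Ext 𝓔.𝔼 C A}
    (h : 𝓔.IsETriangle x y δ) (b : B ⟶ B) (hx : x ≫ b = x) (hy : b ≫ y = y) : IsIso b := by
  obtain ⟨s, hs⟩ := h.exists_desc (b - 𝟙 B) (by simp [hx])
  apply Preadditive.isIso_of_sub_id_comp_sub_id
  nth_rw 2 [← hs]
  simp [← Category.assoc, hy]

/-- Here `c - 1` pulls `δ` back to zero, hence lifts through `y`, and `y ≫ (c - 1) = 0` makes it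
square-zero. -/
theorem isIso_right_of_endo {A B C : 𝒞} {x : A ⟶ B} {y : B ⟶ C} {δ : Ext 𝓔.𝔼 C A}
    (h : 𝓔.IsETriangle x y δ) (c : C ⟶ C) (hy : y ≫ c = y) (hc : pull 𝓔.𝔼 c δ = δ) :
    IsIso c := by
  obtain ⟨s, hs⟩ := h.exists_lift (c - 𝟙 C) (by simp [sub_pull, hc])
  apply Preadditive.isIso_of_sub_id_comp_sub_id
  nth_rw 1 [← hs]
  simp [hy]

/-- Sequences isomorphic to the underlying sequence of an `𝔼`-triangle realise the transported
extension. -/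
theorem of_iso {A B C A' B' C' : 𝒞} {x : A ⟶ B} {y : B ⟶ C} {δ : Ext 𝓔.𝔼 C A}
    {x' : A' ⟶ B'} {y' : B' ⟶ C'} {δ' : Ext 𝓔.𝔼 C' A'} (h : 𝓔.IsETriangle x y δ)
    (a : A ≅ A') (b : B ≅ B') (c : C ≅ C') (hx : x ≫ b.hom = a.hom ≫ x')
    (hy : y ≫ c.hom = b.hom ≫ y') (hδ : push 𝓔.𝔼 a.hom δ = pull 𝓔.𝔼 c.hom δ') :
    𝓔.IsETriangle x' y' δ' := by
  obtain ⟨B₀, x₀, y₀, h₀⟩ := (𝓔.𝔰 δ').exists_eq_mk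
  have hδ' : push 𝓔.𝔼 a.inv δ' = pull 𝓔.𝔼 c.inv δ := by
    have := congrArg (fun ε => pull 𝓔.𝔼 c.inv (push 𝓔.𝔼 a.inv ε)) hδ
    simp only [← push_comp, a.hom_inv_id, push_id] at this
    rw [this, push_pull, ← pull_comp]
    simp
  -- The middle maps `p`, `q` need not be mutually inverse, but both composites fix the outer maps,
  -- so they are invertible.
  obtain ⟨p, hp, hp'⟩ := 𝓔.realisation δ δ' _ _ _ _ h h₀ a.hom c.hom hδ
  obtain ⟨q, hq, hq'⟩ := 𝓔.realisation δ' δ _ _ _ _ h₀ h a.inv c.inv hδ'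
  have h₁ : IsIso (p ≫ q) := h.isIso_mid_of_endo _
    (by rw [reassoc_of% hp, hq]; simp) (by rw [Category.assoc, ← hq', ← reassoc_of% hp']; simp)
  have h₂ : IsIso (q ≫ p) := isIso_mid_of_endo h₀ _
    (by rw [reassoc_of% hq, hp]; simp) (by rw [Category.assoc, ← hp', ← reassoc_of% hq']; simp)
  have : IsIso p := isIso_of_isIso_comp_comp p q h₁ h₂
  refine Eq.trans h₀ (SeqClass.mk_eq_mk_iff.2 ⟨(asIso p).symm ≪≫ b, ?_, ?_⟩)
  · have : x₀ = a.inv ≫ x ≫ p := by simp [hp]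
    simp [this, hx]
  · simp [← hy, hp']

/-- Two `𝔼`-triangles with the same inflation are isomorphic. -/
theorem exists_iso_right {A B C C' : 𝒞} {x : A ⟶ B} {y : B ⟶ C} {δ : Ext 𝓔.𝔼 C A}
    {y' : B ⟶ C'} {δ' : Ext 𝓔.𝔼 C' A} (h : 𝓔.IsETriangle x y δ) (h' : 𝓔.IsETriangle x y' δ') :
    ∃ c : C ≅ C', y ≫ c.hom = y' ∧ pull 𝓔.𝔼 c.hom δ' = δ := by
  obtain ⟨p, hp, hp'⟩ := 𝓔.et3 δ δ' _ _ _ _ h h' (𝟙 A) (𝟙 B) (by simp)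
  obtain ⟨q, hq, hq'⟩ := 𝓔.et3 δ' δ _ _ _ _ h' h (𝟙 A) (𝟙 B) (by simp)
  simp only [push_id, Category.id_comp] at hp hp' hq hq'
  have h₁ : IsIso (p ≫ q) := h.isIso_right_of_endo _ (by rw [reassoc_of% hp', hq'])
    (by rw [pull_comp, ← hq, hp])
  have h₂ : IsIso (q ≫ p) := h'.isIso_right_of_endo _ (by rw [reassoc_of% hq', hp'])
    (by rw [pull_comp, ← hp, hq])
  have : IsIso p := isIso_of_isIso_comp_comp p q h₁ h₂
  exact ⟨asIso p, hp', hp.symm⟩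

/-! ### `𝔼`-triangles with vanishing middle term -/

section Cone

variable {A C : 𝒞} {x : A ⟶ (0 : 𝒞)} {y : (0 : 𝒞) ⟶ C} {δ : Ext 𝓔.𝔼 C A}

/-- ET3 applies because any square ending at the zero object commutes. -/
theorem exists_pull_eq (h : 𝓔.IsETriangle x y δ) {W : 𝒞} (ε : Ext 𝓔.𝔼 W A) :
    ∃ c : W ⟶ C, pull 𝓔.𝔼 c δ = ε := by
  obtain ⟨B', x', y', h'⟩ := (𝓔.𝔰 ε).exists_eq_mk
  obtain ⟨c, hc, -⟩ := 𝓔.et3 ε δ _ _ _ _ h' h (𝟙 A) 0 (by ext)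
  exact ⟨c, by simpa using hc.symm⟩

theorem exists_push_eq (h : 𝓔.IsETriangle x y δ) {W : 𝒞} (ε : Ext 𝓔.𝔼 C W) :
    ∃ a : A ⟶ W, push 𝓔.𝔼 a δ = ε := by
  obtain ⟨B', x', y', h'⟩ := (𝓔.𝔰 ε).exists_eq_mk
  obtain ⟨a, ha, -⟩ := 𝓔.et3op δ ε _ _ _ _ h h' 0 (𝟙 C) (by ext)
  exact ⟨a, by simpa using ha⟩

/-- The difference `c - c'` lifts through the zero object. -/
theorem pull_injective (h : 𝓔.IsETriangle x y δ) {W : 𝒞} {c c' : W ⟶ C}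
    (hc : pull 𝓔.𝔼 c δ = pull 𝓔.𝔼 c' δ) : c = c' := by
  obtain ⟨s, hs⟩ := h.exists_lift (c - c') (by simp [sub_pull, hc])
  rw [← sub_eq_zero, ← hs, (isZero_zero 𝒞).eq_of_src y 0, comp_zero]

theorem push_injective (h : 𝓔.IsETriangle x y δ) {W : 𝒞} {a a' : A ⟶ W}
    (ha : push 𝓔.𝔼 a δ = push 𝓔.𝔼 a' δ) : a = a' := by
  obtain ⟨s, hs⟩ := h.exists_extend (a - a') (by simp [sub_push, ha])
  rw [← sub_eq_zero, ← hs, (isZero_zero 𝒞).eq_of_tgt x 0, zero_comp]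

/-- Every morphism out of an object with a cone `A ⟶ 0 ⟶ C` is the start of an `𝔼`-triangle
which can be rotated. -/
theorem exists_isETriangle_rotate (h : 𝓔.IsETriangle x y δ) {Y : 𝒞} (u : A ⟶ Y) :
    ∃ (Z : 𝒞) (v : Y ⟶ Z) (w : Z ⟶ C), 𝓔.IsETriangle u v (pull 𝓔.𝔼 w δ) ∧
      𝓔.IsETriangle v w (-push 𝓔.𝔼 u δ) := by
  have h₁ := 𝓔.realisation_add δ 0 _ _ _ _ h (zero_right Y)
  simp only [pull_map_zero, push_map_zero, add_zero] at h₁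
  -- This shear turns the projection `A ⊞ Y ⟶ Y` into `(u, 1)`; its entry `-u` is the source of the
  -- sign in rotation.
  let φ : A ⊞ Y ≅ A ⊞ Y :=
    { hom := biprod.lift biprod.fst (biprod.snd - biprod.fst ≫ u)
      inv := biprod.lift biprod.fst (biprod.snd + biprod.fst ≫ u)
      hom_inv_id := by ext <;> simp
      inv_hom_id := by ext <;> simp }
  have h₂ : 𝓔.IsETriangle (biprod.desc u (𝟙 Y)) (0 : Y ⟶ C)
      (push 𝓔.𝔼 (biprod.lift (𝟙 A) (-u)) δ) := by
    refine of_iso h₁ φ ⟨biprod.snd, biprod.inr, by ext; all_goals simp, by simp⟩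
      ⟨biprod.fst, biprod.inl, by ext; all_goals simp, by simp⟩ ?_ ?_ ?_
    · ext <;> simp [φ]
    · ext; simp [(isZero_zero 𝒞).eq_of_src y 0]
    · rw [push_pull, push_pull, ← push_comp]
      congr 2
      ext <;> simp [φ]
  -- ET4 for `u` factored as `A ⟶ A ⊞ Y ⟶ Y`: a split inclusion followed by `(u, 1)`, an inflation
  -- with cone `C`.
  obtain ⟨Z, v, d, w, ε, hd, -, hε, hw, -, hεw⟩ :=
    𝓔.et4 0 _ _ _ _ _ (𝓔.realisation_zero A Y) h₂
  have hdv : d = v := by simpa using congrArg (biprod.inr ≫ ·) hd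
  have hεw' : ε = pull 𝓔.𝔼 w δ := by
    have := congrArg (push 𝓔.𝔼 biprod.fst) hεw
    rw [← push_comp, push_pull, ← push_comp] at this
    simpa using this
  subst hdv hεw'
  refine ⟨Z, d, w, by simpa [IsETriangle] using hε, ?_⟩
  rw [← push_comp, biprod.lift_snd, neg_push] at hw
  exact hw

end Cone

end IsETriangle

/-! ### The triangulated structure -/

variable (𝓔) in
/-- A choice of `𝔼`-triangles `X ⟶ 0 ⟶ T X`. -/
structure Suspension where
  /-- the suspension of an object -/
  obj : 𝒞 → 𝒞
  /-- the universal extension -/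
  ext (X : 𝒞) : Ext 𝓔.𝔼 (obj X) X
  isETriangle (X : 𝒞) : 𝓔.IsETriangle (0 : X ⟶ (0 : 𝒞)) 0 (ext X)

namespace Suspension

variable (S : 𝓔.Suspension)

theorem exists_map {X Y : 𝒞} (f : X ⟶ Y) :
    ∃ g : S.obj X ⟶ S.obj Y, pull 𝓔.𝔼 g (S.ext Y) = push 𝓔.𝔼 f (S.ext X) :=
  (S.isETriangle Y).exists_pull_eq _

/-- The suspension of a morphism. -/
def map {X Y : 𝒞} (f : X ⟶ Y) : S.obj X ⟶ S.obj Y :=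
  (S.exists_map f).choose

theorem pull_map {X Y : 𝒞} (f : X ⟶ Y) :
    pull 𝓔.𝔼 (S.map f) (S.ext Y) = push 𝓔.𝔼 f (S.ext X) :=
  (S.exists_map f).choose_spec

/-- The suspension functor. -/
def functor : 𝒞 ⥤ 𝒞 where
  obj := S.obj
  map := S.map
  -- The choice made in `map` is unique by `pull_injective`, which yields functoriality.
  map_id X := (S.isETriangle X).pull_injective (by simp [pull_map])
  map_comp f g := (S.isETriangle _).pull_injective
    (by rw [pull_map, pull_comp, pull_map, ← push_pull, pull_map, push_comp])

/-- The universal extension in terms of the suspension functor. -/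
def universal (X : 𝒞) : Ext 𝓔.𝔼 (S.functor.obj X) X :=
  S.ext X

theorem isETriangle_universal (X : 𝒞) :
    𝓔.IsETriangle (0 : X ⟶ (0 : 𝒞)) (0 : (0 : 𝒞) ⟶ S.functor.obj X) (S.universal X) :=
  S.isETriangle X

theorem pull_functor_map {X Y : 𝒞} (f : X ⟶ Y) :
    pull 𝓔.𝔼 (S.functor.map f) (S.universal Y) = push 𝓔.𝔼 f (S.universal X) :=
  S.pull_map f

/-- Fullness and faithfulness come from `Hom(X, Y) ≅ 𝔼(TX, Y) ≅ Hom(TX, TY)`. For density, `A ⟶ 0 ⟶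
Y` and `A ⟶ 0 ⟶ TA` share an inflation, so `Y ≅ TA`. -/
theorem isEquivalence_functor (h : ∀ X : 𝒞, 𝓔.IsDeflation (0 : (0 : 𝒞) ⟶ X)) :
    S.functor.IsEquivalence where
  faithful := ⟨fun {X Y f g} hfg => (S.isETriangle_universal X).push_injective
    (by rw [← pull_functor_map, hfg, pull_functor_map])⟩
  full := ⟨fun {X Y} g => by
    obtain ⟨f, hf⟩ := (S.isETriangle_universal X).exists_push_eq (pull 𝓔.𝔼 g (S.universal Y))
    exact ⟨f, (S.isETriangle_universal Y).pull_injective (by rw [pull_functor_map, hf])⟩⟩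
  essSurj := ⟨fun Y => by
    obtain ⟨A, x, δ, hδ⟩ := h Y
    obtain rfl : x = 0 := (isZero_zero 𝒞).eq_of_tgt _ _
    obtain ⟨c, -⟩ := (S.isETriangle_universal A).exists_iso_right hδ
    exact ⟨A, ⟨c⟩⟩⟩

/-- The distinguished triangles: those `X ⟶ Y ⟶ Z ⟶ T X` for which `X ⟶ Y ⟶ Z` realises the
extension classified by `Z ⟶ T X`. -/
def Dist {X Y Z : 𝒞} (u : X ⟶ Y) (v : Y ⟶ Z) (w : Z ⟶ S.functor.obj X) : Prop :=
  𝓔.IsETriangle u v (pull 𝓔.𝔼 w (S.universal X))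

variable {S}

theorem Dist.of_iso {X Y Z X' Y' Z' : 𝒞} {u : X ⟶ Y} {v : Y ⟶ Z} {w : Z ⟶ S.functor.obj X}
    {u' : X' ⟶ Y'} {v' : Y' ⟶ Z'} {w' : Z' ⟶ S.functor.obj X'} (f : X ≅ X') (g : Y ≅ Y')
    (h : Z ≅ Z') (hu : u ≫ g.hom = f.hom ≫ u') (hv : v ≫ h.hom = g.hom ≫ v')
    (hw : w ≫ S.functor.map f.hom = h.hom ≫ w') (H : S.Dist u v w) : S.Dist u' v' w' :=
  IsETriangle.of_iso H f g h hu hv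
    (by rw [push_pull, ← pull_functor_map, ← pull_comp, ← pull_comp, hw])

/-- Cones are unique up to isomorphism. -/
theorem Dist.exists_iso {X Y Z Z' : 𝒞} {u : X ⟶ Y} {v : Y ⟶ Z} {w : Z ⟶ S.functor.obj X}
    {v' : Y ⟶ Z'} {w' : Z' ⟶ S.functor.obj X} (H : S.Dist u v w) (H' : S.Dist u v' w') :
    ∃ h : Z ≅ Z', v ≫ h.hom = v' ∧ h.hom ≫ w' = w := by
  obtain ⟨h, hv, hw⟩ := IsETriangle.exists_iso_right H H'
  exact ⟨h, hv, (S.isETriangle_universal X).pull_injective (by rw [pull_comp, hw])⟩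

variable (S) in
theorem exists_dist_rotate {X Y : 𝒞} (u : X ⟶ Y) :
    ∃ (Z : 𝒞) (v : Y ⟶ Z) (w : Z ⟶ S.functor.obj X),
      S.Dist u v w ∧ S.Dist v w (-(S.functor.map u)) := by
  obtain ⟨Z, v, w, h, h'⟩ := (S.isETriangle_universal X).exists_isETriangle_rotate u
  refine ⟨Z, v, w, h, ?_⟩
  rw [← pull_functor_map, ← neg_pull] at h'
  exact h'

/-- Cones being unique, it suffices that one triangle on `u` rotates. -/
theorem Dist.rotate {X Y Z : 𝒞} {u : X ⟶ Y} {v : Y ⟶ Z} {w : Z ⟶ S.functor.obj X}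
    (H : S.Dist u v w) : S.Dist v w (-(S.functor.map u)) := by
  obtain ⟨Z', v', w', h, h'⟩ := S.exists_dist_rotate u
  obtain ⟨φ, hv, hw⟩ := h.exists_iso H
  exact h'.of_iso (Iso.refl _) φ (Iso.refl _) (by simp [hv]) (by simp [hw]) (by simp)

theorem Dist.exists_hom {X Y Z X' Y' Z' : 𝒞} {u : X ⟶ Y} {v : Y ⟶ Z}
    {w : Z ⟶ S.functor.obj X} {u' : X' ⟶ Y'} {v' : Y' ⟶ Z'} {w' : Z' ⟶ S.functor.obj X'}
    (H : S.Dist u v w) (H' : S.Dist u' v' w') (f : X ⟶ X') (g : Y ⟶ Y')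
    (hu : u ≫ g = f ≫ u') :
    ∃ h : Z ⟶ Z', v ≫ h = g ≫ v' ∧ w ≫ S.functor.map f = h ≫ w' := by
  obtain ⟨h, hδ, hv⟩ := 𝓔.et3 _ _ _ _ _ _ H H' f g hu
  refine ⟨h, hv, (S.isETriangle_universal X').pull_injective ?_⟩
  rw [pull_comp, pull_functor_map, ← push_pull, hδ, pull_comp]

/-- ET4 produces its own cone `E` of `u ≫ v`, which `φ` identifies with the given `Y'`. The
identities involving `k'` are equalities of extensions, tested by `pull_injective`. -/
theorem Dist.octahedron {X Y Z X' Y' Z' : 𝒞} {u : X ⟶ Y} {i : Y ⟶ Z'}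
    {i' : Z' ⟶ S.functor.obj X} {v : Y ⟶ Z} {j : Z ⟶ X'} {j' : X' ⟶ S.functor.obj Y}
    {k : Z ⟶ Y'} {k' : Y' ⟶ S.functor.obj X} (Hu : S.Dist u i i') (Hv : S.Dist v j j')
    (Huv : S.Dist (u ≫ v) k k') :
    ∃ (f : Z' ⟶ Y') (g : Y' ⟶ X'), i ≫ f = v ≫ k ∧ f ≫ k' = i' ∧ k ≫ g = j ∧
      k' ≫ S.functor.map u = g ≫ j' ∧ S.Dist f g (j' ≫ S.functor.map i) := by
  obtain ⟨E, h, d, e, ε, hd, he, hε, hde, hdε, hue⟩ := 𝓔.et4 _ _ _ _ _ _ Hu Hv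
  obtain ⟨φ, hφ, hφε⟩ := IsETriangle.exists_iso_right hε Huv
  refine ⟨d ≫ φ.hom, φ.inv ≫ e, ?_, ?_, ?_, ?_, ?_⟩
  · rw [reassoc_of% hd, hφ]
  · refine (S.isETriangle_universal X).pull_injective ?_
    rw [Category.assoc, pull_comp, pull_comp, hφε, hdε]
  · rw [← hφ, ← he]
    simp
  · rw [← cancel_epi φ.hom]
    refine (S.isETriangle_universal Y).pull_injective ?_
    rw [Category.assoc, φ.hom_inv_id_assoc, pull_comp, pull_comp, pull_functor_map, ← push_pull,
      ← push_pull, hφε, hue, pull_comp]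
  · have := IsETriangle.comp_iso hde φ
    rwa [push_pull, ← pull_functor_map, ← pull_comp] at this

variable (S) in
/-- The triangulated structure given by a suspension. -/
def triangulatedStructure (h : ∀ X : 𝒞, 𝓔.IsDeflation (0 : (0 : 𝒞) ⟶ X)) :
    TriangulatedStructure 𝒞 where
  T := S.functor
  isEquivalence := S.isEquivalence_functor h
  Dist := S.Dist
  tr1_iso _ _ _ _ _ _ f g h hu hv hw H := H.of_iso f g h hu hv hw
  tr1_exists u := by
    obtain ⟨Z, v, w, H, -⟩ := S.exists_dist_rotate u
    exact ⟨Z, v, w, H⟩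
  tr1_id X := by
    have := IsETriangle.zero_right (𝓔 := 𝓔) X
    rwa [← zero_pull 𝓔 (S.universal X)] at this
  tr2 _ _ _ H := H.rotate
  tr3 _ _ _ _ _ _ H H' f g hu := H.exists_hom H' f g hu
  tr4 _ _ _ _ _ _ _ _ Hu Hv Huv := Hu.octahedron Hv Huv

end Suspension

end ExtriangulatedStructure

/-! ### Necessity of the conditions -/

namespace TriangulatedStructure

variable {𝒞 : Type u} [Category.{v} 𝒞] [Preadditive 𝒞] [HasZeroObject 𝒞]
  [HasBinaryBiproducts 𝒞] {𝓣 : TriangulatedStructure 𝒞} {𝓔 : ExtriangulatedStructure.{w} 𝒞}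

theorem IsCompatible.isInflation (h : 𝓣.IsCompatible 𝓔) {X Y : 𝒞} (f : X ⟶ Y) :
    𝓔.IsInflation f := by
  obtain ⟨Z, v, w, H⟩ := 𝓣.tr1_exists f
  exact ⟨Z, v, h _ _ _ H⟩

theorem IsCompatible.isDeflation_zero (h : 𝓣.IsCompatible 𝓔) (X : 𝒞) :
    𝓔.IsDeflation (0 : (0 : 𝒞) ⟶ X) := by
  have := 𝓣.isEquivalence
  let e := 𝓣.T.objObjPreimageIso X
  have H := 𝓣.tr2 _ _ _ (𝓣.tr1_id (𝓣.T.objPreimage X))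
  -- The sign in `-e.inv` absorbs the one introduced by rotating the identity triangle.
  have H' := 𝓣.tr1_iso _ _ _ (0 : 𝓣.T.objPreimage X ⟶ (0 : 𝒞)) (0 : (0 : 𝒞) ⟶ X)
    (-e.inv) (Iso.refl _) (Iso.refl _) e (by simp) (by simp) (by simp) H
  exact ⟨_, _, h _ _ _ H'⟩

end TriangulatedStructure

end

theorem theorem3p1 {𝒞 : Type u} [Category.{v} 𝒞] [Preadditive 𝒞] [HasZeroObject 𝒞]
    [HasBinaryBiproducts 𝒞] (𝓔 : ExtriangulatedStructure.{w} 𝒞) :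
    (∃ 𝓣 : TriangulatedStructure 𝒞, 𝓣.IsCompatible 𝓔) ↔
      ∀ X : 𝒞, 𝓔.IsInflation (0 : X ⟶ (0 : 𝒞)) ∧ 𝓔.IsDeflation (0 : (0 : 𝒞) ⟶ X) := by
  refine ⟨fun ⟨𝓣, h⟩ X => ⟨h.isInflation _, h.isDeflation_zero X⟩, fun h => ?_⟩
  choose T y δ hδ using fun X => (h X).1
  let S : 𝓔.Suspension :=
    { obj := T
      ext := δ
      isETriangle := fun X => by
        rw [← (isZero_zero 𝒞).eq_of_src (y X) 0]
        exact hδ X }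
  -- Compatibility is the definition of `Dist`, with `δ` the pullback of the universal extension.
  exact ⟨S.triangulatedStructure fun X => (h X).2, fun _ _ _ H => ⟨_, H⟩⟩
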